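/- Let $X$ be a measurable space (the instances of a problem), $\mathcal A$ a set of algorithms, and $\mathrm{cost}:\mathcal A\times X\to[0,H]$ a performance measure, measurable in the instance, which is to be minimized or to be maximized. For a probability distribution $D$ on $X$, the error of $A\in\mathcal A$ is $|\mathbb E_{x\sim D}[\mathrm{cost}(A,x)]-\mathrm{opt}(D)|$, where $\mathrm{opt}(D)$ is the infimum (for minimization) or supremum (for maximization) of $\mathbb E_{x\sim D}[\mathrm{cost}(A',x)]$ over $A'\in\mathcal A$, i.e. the value of the optimal algorithm for $D$ if there is one. A finite set $S\subseteq X$ is shattered by $\mathcal A$ if there are reals $(r_x)_{x\in S}$ such that for every $T\subseteq S$ there is $A\in\mathcal A$ with $\mathrm{cost}(A,x)>r_x\iff x\in T$ for all $x\in S$. The pseudo-dimension of $\mathcal A$ is the largest cardinality of a shattered finite set ($+\infty$ if there are arbitrarily large ones). A learning algorithm $L$ maps every finite sample $(x_1,\dots,x_n)$ of instances (repetitions allowed) to an element of $\mathcal A$. It is an empirical risk minimization (ERM) algorithm if its output on every finite sample has the best (least, respectively greatest) average cost on that sample among all elements of $\mathcal A$. It $(\epsilon,\delta)$-learns the optimal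 algorithm in $\mathcal A$ from $m$ samples if, for every probability distribution $D$ on $X$, with probability at least $1-\delta$ over $m$ independent samples $x_1,\dots,x_m\sim D$, the output $L(x_1,\dots,x_m)$ has error at most $\epsilon$. **Corollary.** There is a universal constant $c>0$ such that the following holds for all $X$, $\mathcal A$, $\mathrm{cost}$, $H$ as above, all $\epsilon>0$ and all $\delta\in(0,1]$. Suppose that $\mathcal A$ has finite pseudo-dimension $d$, and let $m\ge0$ be an integer with $$m\ \ge\ c\left(\frac H\epsilon\right)^2\left(d+\ln\frac1\delta\right).$$ Then every ERM algorithm $L$ for which $(x_1,\dots,x_m,y)\mapsto\mathrm{cost}(L(x_1,\dots,x_m),y)$ is a measurable function on $X^m\times X$ $(2\epsilon,\delta)$-learns the optimal algorithm in $\mathcal A$ from $m$ samples. -/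

import Mathlib

open MeasureTheory

namespace AlgSelect

/-- A finite set `S` is (pseudo-)shattered by the class `F` of real-valued functions: there are
witnesses `r x`, `x ∈ S`, such that for every `T ⊆ S` some `h ∈ F` satisfies
`h x > r x ↔ x ∈ T` for all `x ∈ S`. -/
def PseudoShatters {X : Type*} (F : Set (X → ℝ)) (S : Finset X) : Prop :=
  ∃ r : X → ℝ, ∀ T : Finset X, T ⊆ S → ∃ h ∈ F, ∀ x ∈ S, h x > r x ↔ x ∈ T

/-- The pseudo-dimension: the largest cardinality of a shattered finite set, `⊤` if there are
arbitrarily large ones. -/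
noncomputable def pseudoDim {X : Type*} (F : Set (X → ℝ)) : ℕ∞ :=
  ⨆ (S : Finset X) (_ : PseudoShatters F S), (S.card : ℕ∞)

/-- Whether small or large values of the performance measure are the good ones. -/
inductive Goal where
  | minimize
  | maximize

/-- `goal.AsGoodAs a b`: performance `a` is at least as good as performance `b`. -/
def Goal.AsGoodAs : Goal → ℝ → ℝ → Prop
  | .minimize, a, b => a ≤ b
  | .maximize, a, b => b ≤ a

/-- The best value of a family of performances: its infimum or its supremum. It is the value at an
optimal index whenever an optimal index exists. -/
noncomputable def Goal.best {ι : Type*} : Goal → (ι → ℝ) → ℝ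
  | .minimize, v => ⨅ i, v i
  | .maximize, v => ⨆ i, v i

/-- A learning algorithm maps every finite sample of instances in `X` to an element of `𝒜`. -/
abbrev Learner (X 𝒜 : Type*) := (n : ℕ) → (Fin n → X) → 𝒜

/-- The average performance of `A` on a finite sample. -/
noncomputable def avgCost {X 𝒜 : Type*} (cost : 𝒜 → X → ℝ) {n : ℕ} (x : Fin n → X) (A : 𝒜) : ℝ :=
  (∑ i, cost A (x i)) / n

/-- `L` is an empirical risk minimization algorithm: on every finite sample it returns an element
of `𝒜` with the best average performance on the sample. -/
def IsERM {X 𝒜 : Type*} (goal : Goal) (cost : 𝒜 → X → ℝ) (L : Learner X 𝒜) : Prop :=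
  ∀ (n : ℕ) (x : Fin n → X) (A : 𝒜), goal.AsGoodAs (avgCost cost x (L n x)) (avgCost cost x A)

/-- The expected performance of `A` on an instance drawn from `D`. -/
noncomputable def expCost {X 𝒜 : Type*} [MeasurableSpace X] (cost : 𝒜 → X → ℝ) (D : Measure X)
    (A : 𝒜) : ℝ :=
  ∫ x, cost A x ∂D

/-- The error of `A` for `D`: the distance of its expected performance from the optimal one. -/
noncomputable def error {X 𝒜 : Type*} [MeasurableSpace X] (goal : Goal) (cost : 𝒜 → X → ℝ)
    (D : Measure X) (A : 𝒜) : ℝ :=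
  |expCost cost D A - goal.best (expCost cost D)|

/-- `L` `(ε, δ)`-learns the optimal algorithm in `𝒜` from `m` samples: for every distribution `D`,
with probability at least `1 - δ` over `m` independent samples from `D`, the output of `L` has
error at most `ε`. -/
def LearnsOptimal {X 𝒜 : Type*} [MeasurableSpace X] (goal : Goal) (cost : 𝒜 → X → ℝ)
    (L : Learner X 𝒜) (ε δ : ℝ) (m : ℕ) : Prop :=
  ∀ (D : Measure X) [IsProbabilityMeasure D],
    1 - δ ≤ (Measure.pi fun _ : Fin m => D).real {x | error goal cost D (L m x) ≤ ε}

end AlgSelect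

/-! The output of an ERM algorithm is near-optimal once its average cost on the sample is within `ε`
of its expected cost, and the average cost of one fixed near-optimal `A'` is within `ε / 2` of its
expectation. The second event is Hoeffding's inequality for one function. The first needs uniformity
over `𝒜`, obtained by symmetrization and chaining.

Symmetrization: if sample and expectation disagree for the output, then sample and an independent
ghost sample disagree with conditional probability at least 1/2. Swapping `x i` with `y i` preserves
the law of the double sample, so it suffices to fix the double sample and count the sign vectors for
which some `A` has a large signed sum. The supremum over `𝒜` is thus taken only inside a finite
count, and measurability is needed only for the learner's output.

Chaining: a class of pseudo-dimension `d` has `η`-nets of size `(4 / η) ^ (3 d)` in the empirical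
`L¹` distance, uniformly in the sample (`exists_net`). At scale `16 ^ (-k)` the log-cardinality
grows linearly in `k`, while the Hoeffding exponent of the increments grows like `4 ^ k`. Summing
over scales gives the rate `(H / ε) ^ 2 * (d + log (1 / δ))`, without the factor `log (H / ε)` that
a single net would cost. -/

namespace AlgSelect

/-! ### Thresholds, packings and nets in the empirical `L¹` distance -/

open Finset in
/-- A form of the Sauer-Shelah lemma for thresholded function classes. -/
lemma pow_mul_card_traces_le {X : Type*} {F : Set (X → ℝ)} {d : ℕ}
    (hF : ∀ S : Finset X, PseudoShatters F S → S.card ≤ d) [DecidableEq (X × ℝ)]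
    (Q : Finset (X × ℝ)) (𝒢 : Finset (Finset (X × ℝ)))
    (h𝒢 : ∀ s ∈ 𝒢, ∃ h ∈ F, ∀ q, q ∈ s ↔ q ∈ Q ∧ q.2 < h q.1)
    {x : ℝ} (hx : 0 < x) (hx1 : x ≤ 1) :
    x ^ d * (𝒢.card : ℝ) ≤ (1 + x) ^ Q.card := by
  classical
  have hsub : 𝒢.shatterer ⊆ Q.powerset := by
    intro S hS
    rw [mem_shatterer] at hS
    obtain ⟨u, hu, hSu⟩ := hS (subset_refl S)
    obtain ⟨h, -, hh⟩ := h𝒢 u hu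
    rw [mem_powerset]
    intro q hq
    have : q ∈ S ∩ u := by rw [hSu]; exact hq
    exact ((hh q).1 (mem_inter.1 this).2).1
  have hcard : ∀ S ∈ 𝒢.shatterer, S.card ≤ d := by
    intro S hS
    have hSQ := mem_powerset.1 (hsub hS)
    rw [mem_shatterer] at hS
    have htr : ∀ T ⊆ S, ∃ h ∈ F, ∀ q ∈ S, q.2 < h q.1 ↔ q ∈ T := by
      intro T hT
      obtain ⟨u, hu, hSu⟩ := hS hT
      obtain ⟨h, hF', hh⟩ := h𝒢 u hu
      refine ⟨h, hF', fun q hq => ?_⟩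
      rw [← hSu, mem_inter, hh q]
      exact ⟨fun h' => ⟨hq, hSQ hq, h'⟩, fun h' => h'.2.2⟩
    -- Over one instance, a function exceeding the higher threshold exceeds the lower one too, so
    -- the trace `{q'}` cannot be cut out if a lower `q` is also in `S`. A shattered set of
    -- thresholds therefore has at most one over each instance.
    have hle : ∀ q ∈ S, ∀ q' ∈ S, q.1 = q'.1 → q.2 ≤ q'.2 → q = q' := by
      intro q hq q' hq' h1 h2
      obtain ⟨h, -, hh⟩ := htr {q'} (by simpa using hq')
      have h3 := (hh q' hq').2 (by simp)
      have h4 := (hh q hq).1 (by rw [h1]; exact lt_of_le_of_lt h2 h3)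
      simpa using h4
    have hinj : Set.InjOn Prod.fst (S : Set (X × ℝ)) := by
      intro q hq q' hq' h1
      rcases le_total q.2 q'.2 with h2 | h2
      · exact hle q hq q' hq' h1 h2
      · exact (hle q' hq' q hq h1.symm h2).symm
    rw [← card_image_of_injOn hinj]
    apply hF
    have hr : ∀ y : X, ∃ t : ℝ, ∀ q ∈ S, q.1 = y → q.2 = t := by
      intro y
      by_cases hy : ∃ q ∈ S, q.1 = y
      · obtain ⟨q, hq, hqy⟩ := hy
        exact ⟨q.2, fun q' hq' h' => by rw [hinj hq' hq (h'.trans hqy.symm)]⟩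
      · exact ⟨0, fun q hq h' => absurd ⟨q, hq, h'⟩ hy⟩
    choose r hr using hr
    refine ⟨r, fun T hT => ?_⟩
    obtain ⟨h, hF', hh⟩ := htr (S.filter (fun q => q.1 ∈ T)) (filter_subset _ _)
    refine ⟨h, hF', fun y hy => ?_⟩
    obtain ⟨q, hq, rfl⟩ := mem_image.1 hy
    have := hh q hq
    rw [mem_filter, hr q.1 q hq rfl] at this
    exact this.trans ⟨fun h' => h'.2, fun h' => ⟨hq, h'⟩⟩
  -- A family shatters at least as many sets as it has members. The weight `x ^ S.card`, at least `x
  -- ^ d` on shattered sets, replaces a bound on binomial sums by the binomial theorem.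
  calc x ^ d * (𝒢.card : ℝ) ≤ x ^ d * (𝒢.shatterer.card : ℝ) := by
        have := 𝒢.card_le_card_shatterer
        exact mul_le_mul_of_nonneg_left (by exact_mod_cast this) (by positivity)
    _ = ∑ S ∈ 𝒢.shatterer, x ^ d := by rw [sum_const, nsmul_eq_mul, mul_comm]
    _ ≤ ∑ S ∈ 𝒢.shatterer, x ^ S.card * 1 ^ (Q.card - S.card) := by
        refine sum_le_sum fun S hS => ?_
        rw [one_pow, mul_one]
        exact pow_le_pow_of_le_one hx.le hx1 (hcard S hS)
    _ ≤ ∑ S ∈ Q.powerset, x ^ S.card * 1 ^ (Q.card - S.card) :=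
        sum_le_sum_of_subset_of_nonneg hsub fun _ _ _ => by positivity
    _ = (1 + x) ^ Q.card := by rw [sum_pow_mul_eq_add_pow, add_comm]

/-- The thresholds in `[0, H]` that tell `a` from `b` have measure `|a - b|`. -/
lemma integral_threshold {a b H : ℝ} (ha : a ∈ Set.Icc 0 H) (hb : b ∈ Set.Icc 0 H) :
    ∫ t in Set.Icc 0 H, (Set.Ico (min a b) (max a b)).indicator (fun _ => (1 : ℝ)) t = |a - b| := by
  rw [setIntegral_indicator measurableSet_Ico]
  have h : Set.Icc 0 H ∩ Set.Ico (min a b) (max a b) = Set.Ico (min a b) (max a b) :=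
    Set.inter_eq_right.2 fun t ht =>
      ⟨(le_min ha.1 hb.1).trans ht.1, ht.2.le.trans (max_le ha.2 hb.2)⟩
  rw [h]
  simp [max_sub_min_eq_abs, abs_sub_comm]

/-- Some threshold tells apart an average share of the given pairs of functions. -/
lemma exists_threshold {X 𝒜 ι : Type*} [Fintype ι] [Nonempty ι] (cost : 𝒜 → X → ℝ) (z : ι → X)
    {H η : ℝ} (hH : 0 < H) (hc : ∀ A x, cost A x ∈ Set.Icc 0 H) (P : Finset (𝒜 × 𝒜))
    (hP : ∀ p ∈ P, η * Fintype.card ι * H ≤ ∑ i, |cost p.1 (z i) - cost p.2 (z i)|) :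
    ∃ q : X × ℝ, η * P.card ≤
      ((P.filter fun p => ¬ (q.2 < cost p.1 q.1 ↔ q.2 < cost p.2 q.1)).card : ℝ) := by
  classical
  -- Averaging: for `i` and `t ∈ [0, H]` uniform, the threshold `(z i, t)` separates each pair of
  -- `P` with probability at least `η`. If every threshold separated fewer than `η * P.card` pairs,
  -- integration would contradict this.
  by_contra hcon
  simp only [not_exists, not_le] at hcon
  set g : 𝒜 × 𝒜 → ι → ℝ → ℝ := fun p i =>
    (Set.Ico (min (cost p.1 (z i)) (cost p.2 (z i)))
      (max (cost p.1 (z i)) (cost p.2 (z i)))).indicator (fun _ => (1 : ℝ)) with hg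
  have hint : ∀ p i, IntegrableOn (g p i) (Set.Icc 0 H) := fun p i =>
    (integrable_const (1 : ℝ)).indicator measurableSet_Ico
  have hgv : ∀ p i t, g p i t =
      if ¬ (t < cost p.1 (z i) ↔ t < cost p.2 (z i)) then 1 else 0 := by
    intro p i t
    simp only [hg, Set.indicator_apply, Set.mem_Ico, min_le_iff, lt_max_iff]
    congr 1
    rw [eq_iff_iff]
    simp only [← not_lt]
    tauto
  have hcount : ∀ i t, ∑ p ∈ P, g p i t < η * P.card := by
    intro i t
    have := hcon (z i, t)
    simp only [hgv]
    rw [Finset.sum_boole]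
    exact this
  have hs : ∀ i, ∫ t in Set.Icc 0 H, ∑ p ∈ P, g p i t < η * P.card * H := by
    intro i
    have e : ∫ t in Set.Icc 0 H, (η * P.card : ℝ) = η * P.card * H := by
      simp [hH.le, mul_comm]
    rw [← e]
    have hi : IntegrableOn (fun t => ∑ p ∈ P, g p i t) (Set.Icc 0 H) :=
      integrable_finsetSum _ fun p _ => hint p i
    have hc' : IntegrableOn (fun _ : ℝ => (η * P.card : ℝ)) (Set.Icc 0 H) := integrable_const _
    rw [← sub_pos, ← integral_sub hc' hi,
      integral_pos_iff_support_of_nonneg (fun t => sub_nonneg.2 (hcount i t).le) (hc'.sub hi)]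
    have : Function.support (fun t => (η * P.card : ℝ) - ∑ p ∈ P, g p i t) = Set.univ := by
      ext t; simpa using (sub_pos.2 (hcount i t)).ne'
    rw [this]
    simp [hH]
  have h1 : ∑ i : ι, ∫ t in Set.Icc 0 H, ∑ p ∈ P, g p i t < ∑ i : ι, η * P.card * H :=
    Finset.sum_lt_sum_of_nonempty Finset.univ_nonempty fun i _ => hs i
  have h2 : ∑ i : ι, ∫ t in Set.Icc 0 H, ∑ p ∈ P, g p i t
      = ∑ p ∈ P, ∑ i, |cost p.1 (z i) - cost p.2 (z i)| := by
    rw [Finset.sum_comm]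
    refine Finset.sum_congr rfl fun i _ => ?_
    rw [integral_finsetSum _ fun p _ => hint p i]
    exact Finset.sum_congr rfl fun p _ => integral_threshold (hc _ _) (hc _ _)
  have h3 := Finset.sum_le_sum hP
  rw [h2] at h1
  simp only [Finset.sum_const, nsmul_eq_mul, Finset.card_univ] at h1 h3
  linarith

/-- Few thresholds leave few of the given pairs of functions unseparated. -/
lemma exists_thresholds {X 𝒜 ι : Type*} [Fintype ι] [Nonempty ι] (cost : 𝒜 → X → ℝ) (z : ι → X)
    {H η : ℝ} (hH : 0 < H) (hη1 : η ≤ 1) (hc : ∀ A x, cost A x ∈ Set.Icc 0 H)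
    (P : Finset (𝒜 × 𝒜))
    (hP : ∀ p ∈ P, η * Fintype.card ι * H ≤ ∑ i, |cost p.1 (z i) - cost p.2 (z i)|) (k : ℕ) :
    ∃ Q : Finset (X × ℝ), Q.card ≤ k ∧
      ((P.filter fun p => ∀ q ∈ Q, (q.2 < cost p.1 q.1 ↔ q.2 < cost p.2 q.1)).card : ℝ)
        ≤ (1 - η) ^ k * P.card := by
  classical
  induction k with
  | zero => exact ⟨∅, by simp, by simp⟩
  | succ k ih =>
    obtain ⟨Q, hQ, hQP⟩ := ih
    set P' := P.filter fun p => ∀ q ∈ Q, (q.2 < cost p.1 q.1 ↔ q.2 < cost p.2 q.1) with hP'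
    obtain ⟨q, hq⟩ := exists_threshold cost z hH hc P'
      fun p hp => hP p (Finset.mem_filter.1 hp).1
    refine ⟨insert q Q, (Finset.card_insert_le _ _).trans (by omega), ?_⟩
    have e : (P.filter fun p => ∀ q' ∈ insert q Q,
        (q'.2 < cost p.1 q'.1 ↔ q'.2 < cost p.2 q'.1))
        = P'.filter fun p => (q.2 < cost p.1 q.1 ↔ q.2 < cost p.2 q.1) := by
      ext p
      simp only [hP', Finset.mem_filter, Finset.forall_mem_insert]
      tauto
    rw [e]
    have h1 := Finset.card_filter_add_card_filter_not (s := P')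
      (fun p => (q.2 < cost p.1 q.1 ↔ q.2 < cost p.2 q.1))
    have h2 : ((P'.filter fun p => (q.2 < cost p.1 q.1 ↔ q.2 < cost p.2 q.1)).card : ℝ)
      + ((P'.filter fun p => ¬ (q.2 < cost p.1 q.1 ↔ q.2 < cost p.2 q.1)).card : ℝ) = P'.card := by
      exact_mod_cast h1
    calc _ ≤ (1 - η) * (P'.card : ℝ) := by linarith
      _ ≤ (1 - η) * ((1 - η) ^ k * P.card) := by
        gcongr
      _ = _ := by ring

/-- The packing bound for a class of finite pseudo-dimension in the empirical `L¹` distance. -/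
lemma log_card_packing_le {X 𝒜 ι : Type*} [Fintype ι] [Nonempty ι] (cost : 𝒜 → X → ℝ) (z : ι → X)
    {H η : ℝ} {d : ℕ} (hd : 1 ≤ d) (hH : 0 < H) (hη : 0 < η) (hη1 : η ≤ 1)
    (hc : ∀ A x, cost A x ∈ Set.Icc 0 H)
    (hF : ∀ S : Finset X, PseudoShatters (Set.range cost) S → S.card ≤ d)
    (G : Finset 𝒜) (hG0 : G.Nonempty)
    (hG : ∀ A ∈ G, ∀ B ∈ G, A ≠ B →
      η * Fintype.card ι * H ≤ ∑ i, |cost A (z i) - cost B (z i)|) :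
    Real.log G.card ≤ 3 * d * Real.log (4 / η) := by
  classical
  set N : ℝ := (G.card : ℝ) with hN
  have hNpos : 0 < N := by rw [hN]; exact_mod_cast hG0.card_pos
  have hN1 : 1 ≤ N := by rw [hN]; exact_mod_cast hG0.card_pos
  have hL : 0 ≤ Real.log N := Real.log_nonneg hN1
  -- Chosen so that `(1 - η) ^ k ≤ 1 / N ^ 2`: fewer than one of the `N ^ 2 - N` ordered pairs stays
  -- unseparated, so all members of `G` have distinct traces on `Q`.
  set k := ⌈2 * Real.log N / η⌉₊ with hk
  have hk1 : 2 * Real.log N / η ≤ k := Nat.le_ceil _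
  have hk2 : (k : ℝ) ≤ 2 * Real.log N / η + 1 := (Nat.ceil_lt_add_one (by positivity)).le
  obtain ⟨Q, hQ, hQP⟩ := exists_thresholds cost z hH hη1 hc G.offDiag
    (fun p hp => by
      rw [Finset.mem_offDiag] at hp
      exact hG _ hp.1 _ hp.2.1 hp.2.2) k
  have hlt : (1 - η) ^ k * (G.offDiag.card : ℝ) < 1 := by
    have h1 : (1 - η) ^ k ≤ 1 / N ^ 2 := by
      calc (1 - η) ^ k ≤ (Real.exp (-η)) ^ k := by
            gcongr
            linarith [Real.add_one_le_exp (-η)]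
        _ = Real.exp (-(η * k)) := by rw [← Real.exp_nat_mul]; ring_nf
        _ ≤ Real.exp (-(2 * Real.log N)) := by
            rw [div_le_iff₀ hη] at hk1
            refine Real.exp_le_exp.2 ?_
            linarith
        _ = 1 / N ^ 2 := by
            rw [Real.exp_neg, two_mul, Real.exp_add, Real.exp_log hNpos, one_div, sq]
    have h2 : (G.offDiag.card : ℝ) < N ^ 2 := by
      have := Finset.offDiag_card G
      have h3 : 0 < G.card := hG0.card_pos
      have h4 : G.offDiag.card < G.card ^ 2 := by
        rw [this, sq]; exact Nat.sub_lt (Nat.mul_pos h3 h3) h3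
      rw [hN]; exact_mod_cast h4
    calc _ ≤ 1 / N ^ 2 * (G.offDiag.card : ℝ) := by gcongr
      _ < 1 / N ^ 2 * N ^ 2 := by gcongr
      _ = 1 := by field_simp
  have hempty : (G.offDiag.filter fun p =>
      ∀ q ∈ Q, (q.2 < cost p.1 q.1 ↔ q.2 < cost p.2 q.1)) = ∅ := by
    rw [← Finset.card_eq_zero]
    have := hQP.trans_lt hlt
    exact_mod_cast Nat.lt_one_iff.1 (by exact_mod_cast this)
  set tr : 𝒜 → Finset (X × ℝ) := fun A => Q.filter fun q => q.2 < cost A q.1 with htr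
  have hinj : Set.InjOn tr (G : Set 𝒜) := by
    intro A hA B hB hAB
    by_contra hne
    have hmem : (A, B) ∈ (G.offDiag.filter fun p =>
        ∀ q ∈ Q, (q.2 < cost p.1 q.1 ↔ q.2 < cost p.2 q.1)) := by
      refine Finset.mem_filter.2 ⟨Finset.mem_offDiag.2 ⟨hA, hB, hne⟩, fun q hq => ?_⟩
      have := Finset.ext_iff.1 hAB q
      simpa [htr, hq] using this
    rw [hempty] at hmem
    simp at hmem
  -- With this weight, `Q.card * log (1 + η / 4)` is at most about `log N / 2`, which the left side
  -- absorbs.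
  have hx : (0 : ℝ) < η / 4 := by positivity
  have hS := pow_mul_card_traces_le hF Q (G.image tr)
    (fun s hs => by
      obtain ⟨A, -, rfl⟩ := Finset.mem_image.1 hs
      exact ⟨cost A, ⟨A, rfl⟩, fun q => by simp [htr]⟩) hx (by linarith)
  rw [Finset.card_image_of_injOn hinj, ← hN] at hS
  have hlog := Real.log_le_log (by positivity) hS
  rw [Real.log_mul (by positivity) hNpos.ne', Real.log_pow, Real.log_pow] at hlog
  have h5 : Real.log (1 + η / 4) ≤ η / 4 := by
    have := Real.log_le_sub_one_of_pos (show 0 < 1 + η / 4 by positivity)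
    linarith
  have h6 : (Q.card : ℝ) * Real.log (1 + η / 4) ≤ (2 * Real.log N / η + 1) * (η / 4) := by
    have : (Q.card : ℝ) ≤ k := by exact_mod_cast hQ
    gcongr
    · exact Real.log_nonneg (by linarith)
    · linarith
  have h7 : (2 * Real.log N / η + 1) * (η / 4) = Real.log N / 2 + η / 4 := by
    field_simp; ring
  have h8 : Real.log (η / 4) = - Real.log (4 / η) := by
    rw [← Real.log_inv, inv_div]
  have h9 : 1 ≤ Real.log (4 / η) := by
    rw [Real.le_log_iff_exp_le (by positivity)]
    have : (4 : ℝ) ≤ 4 / η := by rw [le_div_iff₀ hη]; linarith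
    linarith [Real.exp_one_lt_d9]
  have h10 : (1 : ℝ) ≤ d := by exact_mod_cast hd
  rw [h8] at hlog
  nlinarith

/-- A class of finite pseudo-dimension has small nets in the empirical `L¹` distance. -/
lemma exists_net {X 𝒜 ι : Type*} [Nonempty 𝒜] [Fintype ι] [Nonempty ι]
    (cost : 𝒜 → X → ℝ) (z : ι → X)
    {H η : ℝ} {d : ℕ} (hd : 1 ≤ d) (hH : 0 < H) (hη : 0 < η) (hη1 : η ≤ 1)
    (hc : ∀ A x, cost A x ∈ Set.Icc 0 H)
    (hF : ∀ S : Finset X, PseudoShatters (Set.range cost) S → S.card ≤ d) :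
    ∃ G : Finset 𝒜, (G.card : ℝ) ≤ Real.exp (3 * d * Real.log (4 / η)) ∧
      ∀ A, ∃ B ∈ G, ∑ i, |cost A (z i) - cost B (z i)| ≤ η * Fintype.card ι * H := by
  classical
  set Sep : Finset 𝒜 → Prop := fun G => G.Nonempty ∧ ∀ A ∈ G, ∀ B ∈ G, A ≠ B →
      η * Fintype.card ι * H ≤ ∑ i, |cost A (z i) - cost B (z i)| with hSep
  have hbound : ∀ G, Sep G → (G.card : ℝ) ≤ Real.exp (3 * d * Real.log (4 / η)) := by
    intro G hG
    have h0 : (0 : ℝ) < G.card := by exact_mod_cast hG.1.card_pos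
    rw [← Real.log_le_iff_le_exp h0]
    exact log_card_packing_le cost z hd hH hη hη1 hc hF G hG.1 hG.2
  -- A separated set of maximal cardinality is a net, since a point far from it could be added.
  set C : Set ℕ := {n | ∃ G, Sep G ∧ G.card = n} with hC
  have hCb : BddAbove C := by
    refine ⟨⌊Real.exp (3 * d * Real.log (4 / η))⌋₊, ?_⟩
    rintro n ⟨G, hG, rfl⟩
    exact Nat.le_floor (hbound G hG)
  have hCn : C.Nonempty := by
    obtain ⟨A⟩ := ‹Nonempty 𝒜›
    refine ⟨1, {A}, ⟨by simp, ?_⟩, by simp⟩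
    intro B hB B' hB' hne
    simp only [Finset.mem_singleton] at hB hB'
    exact absurd (hB.trans hB'.symm) hne
  obtain ⟨G, hG, hGc⟩ := Nat.sSup_mem hCn hCb
  refine ⟨G, hbound G hG, fun A => ?_⟩
  by_contra! hcon
  have hA : A ∉ G := by
    intro hA
    have := hcon A hA
    simp only [sub_self, abs_zero, Finset.sum_const_zero] at this
    have : 0 ≤ η * Fintype.card ι * H := by positivity
    linarith
  have hS : Sep (insert A G) := by
    refine ⟨by simp, fun B hB B' hB' hne => ?_⟩
    rw [Finset.mem_insert] at hB hB'
    rcases hB with rfl | hB <;> rcases hB' with rfl | hB'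
    · exact absurd rfl hne
    · exact (hcon B' hB').le
    · simp only [abs_sub_comm (cost B _)]
      exact (hcon B hB).le
    · exact hG.2 B hB B' hB' hne
  have h1 := le_csSup hCb (show (insert A G).card ∈ C from ⟨_, hS, rfl⟩)
  rw [Finset.card_insert_of_notMem hA, ← hGc] at h1
  omega

/-! ### Random signs and chaining -/

/-- The real sign attached to a Boolean. -/
def sgn (b : Bool) : ℝ := if b then 1 else -1

lemma sgn_sq (b : Bool) : sgn b ^ 2 = 1 := by cases b <;> simp [sgn]

open Finset in
-- Chernoff's method with the optimal parameter `l = s / V`: the exponential moment factors into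
-- `cosh (l * b i) ≤ exp ((l * b i) ^ 2 / 2)`.
lemma card_signs_lt_sum {κ : Type*} [Fintype κ] [DecidableEq κ] (b : κ → ℝ) {V s : ℝ}
    (hV : 0 < V) (hb : ∑ i, b i ^ 2 ≤ V) (hs : 0 < s) :
    ((univ.filter fun σ : κ → Bool => s < ∑ i, sgn (σ i) * b i).card : ℝ)
      ≤ 2 ^ Fintype.card κ * Real.exp (-(s ^ 2 / (2 * V))) := by
  set l := s / V with hl
  have hl0 : 0 < l := by positivity
  have h1 : ((univ.filter fun σ : κ → Bool => s < ∑ i, sgn (σ i) * b i).card : ℝ)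
      * Real.exp (l * s) ≤ ∑ σ : κ → Bool, Real.exp (l * ∑ i, sgn (σ i) * b i) := by
    rw [← nsmul_eq_mul, ← sum_const]
    refine (sum_le_sum fun σ hσ => ?_).trans
      (sum_le_sum_of_subset_of_nonneg (subset_univ _) fun σ _ _ => (Real.exp_pos _).le)
    rw [mem_filter] at hσ
    exact Real.exp_le_exp.2 (mul_le_mul_of_nonneg_left hσ.2.le hl0.le)
  have h2 : ∑ σ : κ → Bool, Real.exp (l * ∑ i, sgn (σ i) * b i)
      = ∏ i, (2 * Real.cosh (l * b i)) := by
    have e : ∀ i, 2 * Real.cosh (l * b i) = ∑ t : Bool, Real.exp (l * (sgn t * b i)) := by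
      intro i
      rw [Fintype.sum_bool, Real.cosh_eq]
      simp [sgn]
      ring
    simp only [e]
    rw [Finset.prod_univ_sum, Fintype.piFinset_univ]
    refine sum_congr rfl fun σ _ => ?_
    rw [mul_sum, Real.exp_sum]
  have h3 : ∏ i, (2 * Real.cosh (l * b i)) ≤ 2 ^ Fintype.card κ * Real.exp (l ^ 2 * V / 2) := by
    rw [prod_mul_distrib, prod_const, card_univ]
    refine mul_le_mul_of_nonneg_left ?_ (by positivity)
    calc ∏ i, Real.cosh (l * b i) ≤ ∏ i, Real.exp ((l * b i) ^ 2 / 2) :=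
          prod_le_prod (fun i _ => (Real.cosh_pos _).le) fun i _ => Real.cosh_le_exp_half_sq _
      _ = Real.exp (l ^ 2 * (∑ i, b i ^ 2) / 2) := by
          rw [← Real.exp_sum, mul_sum, sum_div]; simp only [mul_pow]
      _ ≤ _ := by
          refine Real.exp_le_exp.2 ?_
          gcongr
  have h4 : Real.exp (-(s ^ 2 / (2 * V))) = Real.exp (l ^ 2 * V / 2) * Real.exp (-(l * s)) := by
    rw [← Real.exp_add]
    congr 1
    rw [hl]; field_simp; ring
  have h5 := (h1.trans h2.le).trans h3
  rw [h4, ← mul_assoc, Real.exp_neg, ← div_eq_mul_inv, le_div_iff₀ (Real.exp_pos _)]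
  exact h5

open Finset in
/-- Hoeffding's inequality for random signs, in counting form. -/
lemma card_signs_lt_abs_sum {κ : Type*} [Fintype κ] [DecidableEq κ] (b : κ → ℝ) {V s : ℝ}
    (hV : 0 < V) (hb : ∑ i, b i ^ 2 ≤ V) (hs : 0 < s) :
    ((univ.filter fun σ : κ → Bool => s < |∑ i, sgn (σ i) * b i|).card : ℝ)
      ≤ 2 ^ Fintype.card κ * (2 * Real.exp (-(s ^ 2 / (2 * V)))) := by
  have h1 := card_signs_lt_sum b hV hb hs
  have h2 := card_signs_lt_sum (fun i => - b i) hV (by simpa using hb) hs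
  have h3 : (univ.filter fun σ : κ → Bool => s < |∑ i, sgn (σ i) * b i|)
      ⊆ (univ.filter fun σ : κ → Bool => s < ∑ i, sgn (σ i) * b i)
        ∪ (univ.filter fun σ : κ → Bool => s < ∑ i, sgn (σ i) * - b i) := by
    intro σ
    simp only [mem_filter, mem_univ, true_and, mem_union, mul_neg, sum_neg_distrib, lt_abs]
    exact id
  have h4 := (card_le_card h3).trans (card_union_le _ _)
  have h5 : ((univ.filter fun σ : κ → Bool => s < |∑ i, sgn (σ i) * b i|).card : ℝ)
      ≤ ((univ.filter fun σ : κ → Bool => s < ∑ i, sgn (σ i) * b i).card : ℝ)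
        + ((univ.filter fun σ : κ → Bool => s < ∑ i, sgn (σ i) * - b i).card : ℝ) := by
    exact_mod_cast h4
  linarith

open Finset in
/-- The chaining bound for a sign process indexed by a class with small nets at all scales. -/
lemma card_signs_chaining {𝒜 : Type*} {m d : ℕ} {H ε δ : ℝ} (hm : 0 < m) (hd : 1 ≤ d)
    (hH : 0 < H) (hε : 0 < ε) (hδ : δ ∈ Set.Ioc 0 1)
    (hmc : 10 ^ 6 * (H / ε) ^ 2 * (d + Real.log (1 / δ)) ≤ m)
    (v : 𝒜 → Fin m → ℝ) (hv : ∀ A i, |v A i| ≤ H)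
    (N : ℕ → Finset 𝒜) (hN0 : (N 0).card = 1)
    (hN : ∀ k, ((N k).card : ℝ) ≤ Real.exp (5 * d * (2 * k + 1)))
    (p : ℕ → 𝒜 → 𝒜) (hpN : ∀ k A, p k A ∈ N k)
    (hp : ∀ k A, ∑ i, (v A i - v (p k A) i) ^ 2 ≤ 4 * m * H ^ 2 * (1 / 16) ^ k)
    [DecidablePred fun σ : Fin m → Bool => ∃ A, m * (ε / 2) < |∑ i, sgn (σ i) * v A i|] :
    ((univ.filter fun σ : Fin m → Bool =>
        ∃ A, m * (ε / 2) < |∑ i, sgn (σ i) * v A i|).card : ℝ) ≤ 2 ^ m * (δ / 4) := by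
  classical
  have hm' : (0 : ℝ) < m := by exact_mod_cast hm
  -- The chain starts at 0, so its first increment `u 0` is the single vector coming from the
  -- one-point net `N 0`.
  set w : ℕ → 𝒜 → Fin m → ℝ := fun k A i => match k with
    | 0 => 0
    | k + 1 => v (p k A) i with hw
  set u : ℕ → 𝒜 → Fin m → ℝ := fun k A i => w (k + 1) A i - w k A i with hu
  -- 136 = 16 · (2 · 4 + 2 · 4 / 16): an increment joins approximations at two consecutive scales.
  set V : ℕ → ℝ := fun k => 136 * m * H ^ 2 * (1 / 16) ^ k with hVdef
  have hVpos : ∀ k, 0 < V k := fun k => by simp only [hVdef]; positivity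
  have huV : ∀ k A, ∑ i, u k A i ^ 2 ≤ V k := by
    intro k A
    cases k with
    | zero =>
      simp only [hu, hw, hVdef, sub_zero, pow_zero, mul_one]
      calc ∑ i, v (p 0 A) i ^ 2 ≤ ∑ i : Fin m, H ^ 2 :=
            sum_le_sum fun i _ => sq_le_sq' (by linarith [abs_le.1 (hv (p 0 A) i)])
              (abs_le.1 (hv (p 0 A) i)).2
        _ = m * H ^ 2 := by simp
        _ ≤ _ := by nlinarith [mul_pos hm' (pow_pos hH 2)]
    | succ k =>
      simp only [hu, hw, hVdef]
      have h1 := hp k A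
      have h2 := hp (k + 1) A
      calc ∑ i, (v (p (k + 1) A) i - v (p k A) i) ^ 2
          ≤ ∑ i, (2 * (v A i - v (p k A) i) ^ 2 + 2 * (v A i - v (p (k + 1) A) i) ^ 2) :=
            sum_le_sum fun i _ => by
              nlinarith [sq_nonneg ((v A i - v (p k A) i) + (v A i - v (p (k + 1) A) i))]
        _ = 2 * (∑ i, (v A i - v (p k A) i) ^ 2) + 2 * ∑ i, (v A i - v (p (k + 1) A) i) ^ 2 := by
            rw [sum_add_distrib, mul_sum, mul_sum]
        _ ≤ _ := by rw [pow_succ (1 / 16 : ℝ)] at h2 ⊢; linarith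
  have hU : ∀ k : ℕ, ∃ U : Finset (Fin m → ℝ), (U.card : ℝ) ≤ Real.exp (20 * d * k) ∧
      (∀ A, u k A ∈ U) ∧ ∀ b ∈ U, ∑ i, b i ^ 2 ≤ V k := by
    intro k
    have key : ∃ U : Finset (Fin m → ℝ), (U.card : ℝ) ≤ Real.exp (20 * d * k) ∧
        (∀ A, u k A ∈ U) := by
      cases k with
      | zero =>
        refine ⟨(N 0).image v, ?_, fun A => mem_image.2 ⟨p 0 A, hpN 0 A, ?_⟩⟩
        · have : ((N 0).image v).card ≤ 1 := card_image_le.trans hN0.le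
          simpa using this
        · ext i; simp [hu, hw]
      | succ k =>
        refine ⟨((N (k + 1)) ×ˢ (N k)).image fun q => v q.1 - v q.2, ?_,
          fun A => mem_image.2 ⟨(p (k + 1) A, p k A),
            mem_product.2 ⟨hpN _ A, hpN _ A⟩, by ext i; simp [hu, hw]⟩⟩
        have h1 : (((N (k + 1)) ×ˢ (N k)).image fun q => v q.1 - v q.2).card
            ≤ (N (k + 1)).card * (N k).card := card_image_le.trans (card_product _ _).le
        calc _ ≤ ((N (k + 1)).card : ℝ) * ((N k).card : ℝ) := by exact_mod_cast h1
          _ ≤ Real.exp (5 * d * (2 * (k + 1 : ℕ) + 1)) * Real.exp (5 * d * (2 * k + 1)) := by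
              gcongr
              · exact hN _
              · exact hN _
          _ = _ := by rw [← Real.exp_add]; congr 1; push_cast; ring
    obtain ⟨U, hUc, hUA⟩ := key
    -- Most differences of net points are not increments of any chain and may be long; only the
    -- short ones are kept.
    refine ⟨U.filter fun b => ∑ i, b i ^ 2 ≤ V k, ?_, fun A => mem_filter.2 ⟨hUA A, huV k A⟩,
      fun b hb => (mem_filter.1 hb).2⟩
    exact le_trans (by exact_mod_cast card_filter_le _ _) hUc
  choose U hUc hUA hUV using hU
  -- Beyond scale `K` the remainder is at most `m * (ε / 8)` for every choice of signs, by
  -- Cauchy-Schwarz.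
  obtain ⟨K, hK⟩ : ∃ K : ℕ, (1 / 4 : ℝ) ^ K < ε / (16 * H) :=
    exists_pow_lt_of_lt_one (by positivity) (by norm_num)
  -- These allowances sum to at most `m * (ε / 4)`; with the remainder the total stays below `m * (ε
  -- / 2)`.
  set s : ℕ → ℝ := fun k => m * (ε / 8 * (1 / 2) ^ k) with hs
  have hspos : ∀ k, 0 < s k := fun k => by simp only [hs]; positivity
  have hsub : (univ.filter fun σ : Fin m → Bool =>
        ∃ A, m * (ε / 2) < |∑ i, sgn (σ i) * v A i|)
      ⊆ (range (K + 1)).biUnion fun k => (U k).biUnion fun b =>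
        univ.filter fun σ : Fin m → Bool => s k < |∑ i, sgn (σ i) * b i| := by
    intro σ hσ
    obtain ⟨A, hA⟩ := (mem_filter.1 hσ).2
    by_contra hcon
    simp only [mem_biUnion, mem_filter, mem_univ, true_and, not_exists, not_and, not_lt] at hcon
    have h1 : ∀ k ∈ range (K + 1), |∑ i, sgn (σ i) * u k A i| ≤ s k := fun k hk =>
      hcon k hk _ (hUA k A)
    have h2 : ∀ i, v A i = (∑ k ∈ range (K + 1), u k A i) + (v A i - v (p K A) i) := by
      intro i
      simp only [hu]
      rw [sum_range_sub (fun k => w k A i)]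
      simp [hw]
    have h3 : ∑ i, sgn (σ i) * v A i = (∑ k ∈ range (K + 1), ∑ i, sgn (σ i) * u k A i)
        + ∑ i, sgn (σ i) * (v A i - v (p K A) i) := by
      rw [sum_comm, ← sum_add_distrib]
      refine sum_congr rfl fun i _ => ?_
      rw [← mul_sum, ← mul_add, ← h2 i]
    have h4 : |∑ i, sgn (σ i) * (v A i - v (p K A) i)| ≤ m * (ε / 8) := by
      have h5 : (∑ i, sgn (σ i) * (v A i - v (p K A) i)) ^ 2 ≤ (m * (2 * H * (1 / 4) ^ K)) ^ 2 := by
        have := sq_sum_le_card_mul_sum_sq (s := univ)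
          (f := fun i => sgn (σ i) * (v A i - v (p K A) i))
        simp only [mul_pow, sgn_sq, one_mul, card_univ, Fintype.card_fin] at this
        have h6 := mul_le_mul_of_nonneg_left (hp K A) hm'.le
        have h7 : ((1 / 4 : ℝ) ^ K) ^ 2 = (1 / 16) ^ K := by
          rw [← pow_mul, mul_comm, pow_mul]; norm_num
        calc _ ≤ _ := this
          _ ≤ _ := h6
          _ = _ := by rw [mul_pow, mul_pow, mul_pow, h7]; ring
      have h8 := abs_le_of_sq_le_sq h5 (by positivity)
      rw [lt_div_iff₀ (by positivity)] at hK
      calc _ ≤ m * (2 * H * (1 / 4) ^ K) := h8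
        _ ≤ _ := by gcongr; linarith
    have h9 : ∑ k ∈ range (K + 1), s k ≤ m * (ε / 4) := by
      simp only [hs, ← mul_sum]
      have := sum_geometric_two_le (K + 1)
      gcongr
      nlinarith
    have h10 : |∑ i, sgn (σ i) * v A i| ≤ m * (ε / 4) + m * (ε / 8) := by
      rw [h3]
      refine (abs_add_le _ _).trans (add_le_add ?_ h4)
      exact ((abs_sum_le_sum_abs _ _).trans (sum_le_sum h1)).trans h9
    nlinarith [mul_pos hm' hε]
  have hl0 : 0 ≤ Real.log (1 / δ) := Real.log_nonneg (by rw [le_div_iff₀ hδ.1]; linarith [hδ.2])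
  have hd1 : (1 : ℝ) ≤ d := by exact_mod_cast hd
  have hterm : ∀ k : ℕ, (U k).card * (2 * Real.exp (-(s k ^ 2 / (2 * V k))))
      ≤ δ / 8 * (1 / 2) ^ k := by
    intro k
    have e1 : s k ^ 2 / (2 * V k) = m * (ε / H) ^ 2 / 17408 * 4 ^ k := by
      have e2 : (1 / 2 : ℝ) ^ k = 1 / 2 ^ k := by rw [div_pow, one_pow]
      have e3 : (1 / 16 : ℝ) ^ k = 1 / (2 ^ k) ^ 4 := by
        rw [div_pow, one_pow, ← pow_mul, mul_comm, pow_mul]; norm_num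
      have e4 : (4 : ℝ) ^ k = (2 ^ k) ^ 2 := by rw [← pow_mul, mul_comm, pow_mul]; norm_num
      simp only [hs, hVdef, e2, e3, e4]
      field_simp
      ring
    have e5 : 50 * (d + Real.log (1 / δ)) ≤ m * (ε / H) ^ 2 / 17408 := by
      have h1 : 10 ^ 6 * (d + Real.log (1 / δ)) ≤ m * (ε / H) ^ 2 := by
        calc 10 ^ 6 * (d + Real.log (1 / δ))
            = 10 ^ 6 * (H / ε) ^ 2 * (d + Real.log (1 / δ)) * (ε / H) ^ 2 := by field_simp
          _ ≤ _ := by gcongr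
      linarith
    have e6 : (k : ℝ) + 1 ≤ 4 ^ k := by
      have := one_add_mul_le_pow (show (-2 : ℝ) ≤ 3 by norm_num) k
      norm_num at this
      have hk : (0 : ℝ) ≤ k := by positivity
      linarith
    -- The exponent is at least `50 * (d + log (1 / δ)) * (k + 1)`, which pays for the entropy `20 *
    -- d * k` and leaves a geometric decay in `k`. This is where the constant `10 ^ 6` is spent: `10
    -- ^ 6 / 17408 > 50`.
    have e7 : 20 * d * k + -(s k ^ 2 / (2 * V k)) ≤ -Real.log (1 / δ) + (k + 1 : ℕ) * (-3) := by
      rw [e1]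
      have h1 : 50 * (d + Real.log (1 / δ)) * (k + 1) ≤ m * (ε / H) ^ 2 / 17408 * 4 ^ k := by
        gcongr
      have hk : (0 : ℝ) ≤ k := by positivity
      push_cast
      nlinarith [mul_nonneg hk hl0, mul_nonneg hk (sub_nonneg.2 hd1)]
    have e8 : Real.exp (-3) ≤ 1 / 16 := by
      have h1 : (16 : ℝ) ≤ Real.exp 3 := by
        have h2 := Real.exp_one_gt_d9
        have h3 : Real.exp 3 = Real.exp 1 ^ 3 := by rw [← Real.exp_nat_mul]; norm_num
        rw [h3]
        calc (16 : ℝ) ≤ 2.7 ^ 3 := by norm_num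
          _ ≤ _ := by gcongr; linarith
      rw [Real.exp_neg, ← one_div]
      gcongr
    calc (U k).card * (2 * Real.exp (-(s k ^ 2 / (2 * V k))))
        ≤ Real.exp (20 * d * k) * (2 * Real.exp (-(s k ^ 2 / (2 * V k)))) := by
          gcongr; exact hUc k
      _ = 2 * Real.exp (20 * d * k + -(s k ^ 2 / (2 * V k))) := by rw [Real.exp_add]; ring
      _ ≤ 2 * Real.exp (-Real.log (1 / δ) + (k + 1 : ℕ) * (-3)) := by gcongr
      _ = 2 * (δ * Real.exp (-3) ^ (k + 1)) := by
          rw [Real.exp_add, Real.exp_nat_mul, Real.exp_neg, Real.exp_log (by simpa using hδ.1)]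
          simp
      _ ≤ 2 * (δ * (1 / 16) ^ (k + 1)) := by have := hδ.1; gcongr
      _ = δ / 8 * (1 / 16) ^ k := by ring
      _ ≤ δ / 8 * (1 / 2) ^ k := by have := hδ.1; gcongr; norm_num
  calc _ ≤ (((range (K + 1)).biUnion fun k => (U k).biUnion fun b =>
        univ.filter fun σ : Fin m → Bool => s k < |∑ i, sgn (σ i) * b i|).card : ℝ) := by
        exact_mod_cast card_le_card hsub
    _ ≤ ∑ k ∈ range (K + 1), ∑ b ∈ U k,
        ((univ.filter fun σ : Fin m → Bool => s k < |∑ i, sgn (σ i) * b i|).card : ℝ) := by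
        exact_mod_cast card_biUnion_le.trans (sum_le_sum fun k _ => card_biUnion_le)
    _ ≤ ∑ k ∈ range (K + 1), ∑ b ∈ U k, 2 ^ m * (2 * Real.exp (-(s k ^ 2 / (2 * V k)))) := by
        refine sum_le_sum fun k _ => sum_le_sum fun b hb => ?_
        simpa using card_signs_lt_abs_sum b (hVpos k) (hUV k b hb) (hspos k)
    _ = 2 ^ m * ∑ k ∈ range (K + 1), (U k).card * (2 * Real.exp (-(s k ^ 2 / (2 * V k)))) := by
        rw [mul_sum]
        refine sum_congr rfl fun k _ => ?_
        rw [sum_const, nsmul_eq_mul]; ring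
    _ ≤ 2 ^ m * ∑ k ∈ range (K + 1), δ / 8 * (1 / 2) ^ k :=
        mul_le_mul_of_nonneg_left (sum_le_sum fun k _ => hterm k) (by positivity)
    _ ≤ 2 ^ m * (δ / 4) := by
        rw [← mul_sum]
        have := sum_geometric_two_le (K + 1)
        have := hδ.1
        gcongr
        nlinarith

open Finset in
/-- Uniform deviation of the symmetrized process on a fixed double sample. -/
lemma card_signs_double_sample {X 𝒜 : Type*} [Nonempty 𝒜] {m d : ℕ} {H ε δ : ℝ} (hm : 0 < m)
    (hd : 1 ≤ d) (hH : 0 < H) (hε : 0 < ε) (hδ : δ ∈ Set.Ioc 0 1)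
    (hmc : 10 ^ 6 * (H / ε) ^ 2 * (d + Real.log (1 / δ)) ≤ m)
    (cost : 𝒜 → X → ℝ) (hc : ∀ A x, cost A x ∈ Set.Icc 0 H)
    (hF : ∀ S : Finset X, PseudoShatters (Set.range cost) S → S.card ≤ d)
    (x y : Fin m → X)
    [DecidablePred fun σ : Fin m → Bool =>
      ∃ A, m * (ε / 2) < |∑ i, sgn (σ i) * (cost A (y i) - cost A (x i))|] :
    ((univ.filter fun σ : Fin m → Bool =>
        ∃ A, m * (ε / 2) < |∑ i, sgn (σ i) * (cost A (y i) - cost A (x i))|).card : ℝ)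
      ≤ 2 ^ m * (δ / 4) := by
  have hm' : (0 : ℝ) < m := by exact_mod_cast hm
  have : Nonempty (Fin m ⊕ Fin m) := ⟨Sum.inl ⟨0, hm⟩⟩
  have hd1 : (1 : ℝ) ≤ d := by exact_mod_cast hd
  obtain ⟨A₀⟩ := ‹Nonempty 𝒜›
  have hnet : ∀ k : ℕ, ∃ G : Finset 𝒜, (k = 0 → G.card = 1) ∧
      (G.card : ℝ) ≤ Real.exp (5 * d * (2 * k + 1)) ∧
      ∀ A, ∃ B ∈ G, ∑ i, |cost A (Sum.elim x y i) - cost B (Sum.elim x y i)|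
        ≤ (1 / 16) ^ k * Fintype.card (Fin m ⊕ Fin m) * H := by
    intro k
    -- At scale 1 any single point is a net, as costs lie in `[0, H]`.
    rcases Nat.eq_zero_or_pos k with rfl | hk
    · refine ⟨{A₀}, fun _ => by simp, ?_, fun A => ⟨A₀, by simp, ?_⟩⟩
      · simp
      · calc ∑ i, |cost A (Sum.elim x y i) - cost A₀ (Sum.elim x y i)|
            ≤ ∑ i : Fin m ⊕ Fin m, H := sum_le_sum fun i _ => by
              have h1 := hc A (Sum.elim x y i)
              have h2 := hc A₀ (Sum.elim x y i)
              exact abs_le.2 ⟨by linarith [h1.1, h2.2], by linarith [h1.2, h2.1]⟩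
          _ = _ := by simp
    · have : Nonempty 𝒜 := ⟨A₀⟩
      obtain ⟨G, hG, hGA⟩ := exists_net cost (Sum.elim x y) (η := (1 / 16) ^ k) hd hH
        (by positivity) (pow_le_one₀ (by norm_num) (by norm_num)) hc hF
      refine ⟨G, fun h => by omega, hG.trans (Real.exp_le_exp.2 ?_), hGA⟩
      have e : (4 : ℝ) / (1 / 16) ^ k = 4 ^ (2 * k + 1) := by
        rw [div_pow, one_pow, pow_succ, pow_mul]; norm_num; ring
      have h4 : Real.log 4 ≤ 5 / 3 := by
        have : Real.log 4 = 2 * Real.log 2 := by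
          rw [show (4 : ℝ) = 2 ^ 2 by norm_num, Real.log_pow]; norm_num
        rw [this]; linarith [Real.log_two_lt_d9]
      rw [e, Real.log_pow]
      push_cast
      have hk0 : (0 : ℝ) ≤ d * (2 * k + 1) := by positivity
      nlinarith
  choose N hN0 hN hNA using hnet
  choose p hpN hp using hNA
  refine card_signs_chaining hm hd hH hε hδ hmc (fun A i => cost A (y i) - cost A (x i))
    (fun A i => ?_) N (hN0 0 rfl) hN p hpN fun k A => ?_
  · have h1 := hc A (x i)
    have h2 := hc A (y i)
    exact abs_le.2 ⟨by linarith [h1.2, h2.1], by linarith [h1.1, h2.2]⟩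
  · have h1 := hp k A
    rw [Fintype.sum_sum_type] at h1
    simp only [Sum.elim_inl, Sum.elim_inr, Fintype.card_sum, Fintype.card_fin] at h1
    -- Boundedness turns `L¹` nets into `L²` nets: `L¹` radius `16 ^ (-k)` becomes `L²` radius of
    -- order `4 ^ (-k)`.
    have hsq : ∀ B C t, (cost B t - cost C t) ^ 2 ≤ H * |cost B t - cost C t| := by
      intro B C t
      have h1 := hc B t
      have h2 := hc C t
      rw [← sq_abs, sq]
      exact mul_le_mul_of_nonneg_right
        (abs_le.2 ⟨by linarith [h1.1, h2.2], by linarith [h1.2, h2.1]⟩) (abs_nonneg _)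
    calc ∑ i, ((cost A (y i) - cost A (x i)) - (cost (p k A) (y i) - cost (p k A) (x i))) ^ 2
        ≤ ∑ i, (2 * H * |cost A (x i) - cost (p k A) (x i)|
            + 2 * H * |cost A (y i) - cost (p k A) (y i)|) := sum_le_sum fun i _ => by
          have := hsq A (p k A) (x i)
          have := hsq A (p k A) (y i)
          nlinarith [sq_nonneg ((cost A (y i) - cost (p k A) (y i))
            + (cost A (x i) - cost (p k A) (x i)))]
      _ = 2 * H * ((∑ i, |cost A (x i) - cost (p k A) (x i)|)
            + ∑ i, |cost A (y i) - cost (p k A) (y i)|) := by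
          rw [sum_add_distrib, ← mul_sum, ← mul_sum, mul_add]
      _ ≤ 2 * H * ((1 / 16) ^ k * ((m + m : ℕ) : ℝ) * H) := by gcongr
      _ = _ := by push_cast; ring

/-! ### Concentration for a single function -/

/-- Hoeffding's inequality for the sample sum of a bounded function. -/
lemma measureReal_hoeffding {X : Type*} [MeasurableSpace X] (D : Measure X)
    [IsProbabilityMeasure D] {f : X → ℝ} (hf : Measurable f) {H : ℝ}
    (hfb : ∀ x, f x ∈ Set.Icc 0 H) {m : ℕ} {s : ℝ} (hs : 0 ≤ s) :
    (Measure.pi fun _ : Fin m => D).real {x | s ≤ |∑ i, f (x i) - m * ∫ y, f y ∂D|}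
      ≤ 2 * Real.exp (-s ^ 2 / (2 * (m * (H / 2) ^ 2))) := by
  set μ := Measure.pi fun _ : Fin m => D with hμ
  have key : ∀ (g : X → ℝ) (a b : ℝ), Measurable g → (∀ x, g x ∈ Set.Icc a b) → b - a = H →
      μ.real {x | s ≤ ∑ i, (g (x i) - ∫ y, g y ∂D)}
        ≤ Real.exp (-s ^ 2 / (2 * (m * (H / 2) ^ 2))) := by
    intro g a b hg hgb hab
    have hind : ProbabilityTheory.iIndepFun
        (fun (i : Fin m) (x : Fin m → X) => g (x i) - ∫ y, g y ∂D) μ :=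
      ProbabilityTheory.iIndepFun_pi (X := fun _ y => g y - ∫ y, g y ∂D)
        fun i => (hg.sub_const _).aemeasurable
    have hsub : ∀ i ∈ (Finset.univ : Finset (Fin m)), ProbabilityTheory.HasSubgaussianMGF
        (fun (x : Fin m → X) => g (x i) - ∫ y, g y ∂D) ((‖b - a‖₊ / 2) ^ 2) μ := by
      intro i _
      have h1 := ProbabilityTheory.hasSubgaussianMGF_of_mem_Icc (μ := μ)
        (X := fun x : Fin m → X => g (x i)) (a := a) (b := b)
        (hg.comp (measurable_pi_apply i)).aemeasurable (Filter.Eventually.of_forall fun x => hgb _)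
      have h2 : ∫ x : Fin m → X, g (x i) ∂μ = ∫ y, g y ∂D := by
        have h := measurePreserving_eval (fun _ : Fin m => D) i
        rw [← h.map_eq, integral_map h.measurable.aemeasurable hg.aestronglyMeasurable]
      rwa [h2] at h1
    have h3 := ProbabilityTheory.HasSubgaussianMGF.measure_sum_ge_le_of_iIndepFun hind hsub hs
    refine h3.trans (le_of_eq ?_)
    simp [hab, div_pow]
  have h1 := key f 0 H hf hfb (by ring)
  have h2 := key (fun x => - f x) (-H) 0 hf.neg
    (fun x => ⟨neg_le_neg (hfb x).2, neg_nonpos.2 (hfb x).1⟩) (by ring)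
  have h3 : {x : Fin m → X | s ≤ |∑ i, f (x i) - m * ∫ y, f y ∂D|}
      ⊆ {x | s ≤ ∑ i, (f (x i) - ∫ y, f y ∂D)} ∪ {x | s ≤ ∑ i, (- f (x i) - ∫ y, - f y ∂D)} := by
    intro x hx
    simp only [Set.mem_ofPred_eq, Set.mem_union, Finset.sum_sub_distrib, Finset.sum_neg_distrib,
      integral_neg, Finset.sum_const, Finset.card_univ, Fintype.card_fin, nsmul_eq_mul,
      le_abs] at hx ⊢
    rcases hx with h | h
    · exact Or.inl h
    · right; linarith
  have h4 := (measureReal_mono h3 (measure_ne_top μ _)).trans (measureReal_union_le _ _)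
  linarith

/-- A sample of the size in question determines the mean of one function. -/
lemma measureReal_deviation_le {X : Type*} [MeasurableSpace X] (D : Measure X)
    [IsProbabilityMeasure D] {f : X → ℝ} (hf : Measurable f) {m d : ℕ} {H ε δ : ℝ} (hm : 0 < m)
    (hd : 1 ≤ d) (hH : 0 < H) (hε : 0 < ε) (hδ : δ ∈ Set.Ioc 0 1)
    (hmc : 10 ^ 6 * (H / ε) ^ 2 * (d + Real.log (1 / δ)) ≤ m)
    (hfb : ∀ x, f x ∈ Set.Icc 0 H) :
    (Measure.pi fun _ : Fin m => D).real
      {x | m * (ε / 2) ≤ |∑ i, f (x i) - m * ∫ y, f y ∂D|} ≤ δ / 2 := by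
  have hm' : (0 : ℝ) < m := by exact_mod_cast hm
  have hd1 : (1 : ℝ) ≤ d := by exact_mod_cast hd
  have hl0 : 0 ≤ Real.log (1 / δ) := Real.log_nonneg (by rw [le_div_iff₀ hδ.1]; linarith [hδ.2])
  refine (measureReal_hoeffding D hf hfb (by positivity)).trans ?_
  have h1 : 10 ^ 6 * (d + Real.log (1 / δ)) ≤ m * (ε / H) ^ 2 := by
    calc 10 ^ 6 * (d + Real.log (1 / δ))
        = 10 ^ 6 * (H / ε) ^ 2 * (d + Real.log (1 / δ)) * (ε / H) ^ 2 := by field_simp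
      _ ≤ _ := by gcongr
  have h2 : -(m * (ε / 2)) ^ 2 / (2 * (m * (H / 2) ^ 2)) = -(m * (ε / H) ^ 2 / 2) := by
    field_simp
  rw [h2]
  have h3 : Real.exp (-(m * (ε / H) ^ 2 / 2)) ≤ Real.exp (-3) * δ := by
    calc _ ≤ Real.exp (-3 + -Real.log (1 / δ)) := Real.exp_le_exp.2 (by linarith)
      _ = _ := by
        rw [Real.exp_add, Real.exp_neg (Real.log _), Real.exp_log (by simpa using hδ.1)]
        simp
  have h4 : Real.exp (-3) ≤ 1 / 4 := by
    rw [Real.exp_neg, ← one_div]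
    have := Real.add_one_le_exp (3 : ℝ)
    gcongr
    linarith
  nlinarith [hδ.1]

/-! ### Symmetrization by a ghost sample -/

/-- Exchange of the two halves of a double sample in the coordinates where `σ` is `false`. -/
def exchange {X : Type*} {m : ℕ} (σ : Fin m → Bool) (p : (Fin m → X) × (Fin m → X)) :
    (Fin m → X) × (Fin m → X) :=
  (fun i => if σ i then p.1 i else p.2 i, fun i => if σ i then p.2 i else p.1 i)

/-- The pairs `(x i, y i)` are independent with law `D.prod D`, which is invariant under swapping;
the exchange acts on each pair separately. -/
lemma measurePreserving_exchange {X : Type*} [MeasurableSpace X] (D : Measure X)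
    [IsProbabilityMeasure D] {m : ℕ} (σ : Fin m → Bool) :
    MeasurePreserving (exchange σ)
      ((Measure.pi fun _ : Fin m => D).prod (Measure.pi fun _ : Fin m => D))
      ((Measure.pi fun _ : Fin m => D).prod (Measure.pi fun _ : Fin m => D)) := by
  have h1 := measurePreserving_arrowProdEquivProdArrow X X (Fin m) (fun _ => D) (fun _ => D)
  have h2 : MeasurePreserving
      (fun (a : Fin m → X × X) i => (if σ i then id else Prod.swap : X × X → X × X) (a i))
      (Measure.pi fun _ : Fin m => D.prod D) (Measure.pi fun _ : Fin m => D.prod D) := by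
    refine measurePreserving_pi (fun _ => D.prod D) (fun _ => D.prod D)
      (f := fun i => (if σ i then id else Prod.swap : X × X → X × X)) fun i => ?_
    split_ifs
    · exact MeasurePreserving.id _
    · exact Measure.measurePreserving_swap
  have h3 := h1.comp (h2.comp (h1.symm (MeasurableEquiv.arrowProdEquivProdArrow X X (Fin m))))
  convert h3 using 1
  funext p
  refine Prod.ext (funext fun i => ?_) (funext fun i => ?_)
  · change (if σ i then p.1 i else p.2 i)
      = ((if σ i then id else Prod.swap : X × X → X × X) (p.1 i, p.2 i)).1
    split_ifs <;> rfl
  · change (if σ i then p.2 i else p.1 i)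
      = ((if σ i then id else Prod.swap : X × X → X × X) (p.1 i, p.2 i)).2
    split_ifs <;> rfl

/-- The output of a learner has nearly the same sum of costs on its sample and on a ghost sample. -/
lemma measure_ghost_deviation_le {X 𝒜 : Type*} [MeasurableSpace X] [Nonempty 𝒜] (D : Measure X)
    [IsProbabilityMeasure D] {m d : ℕ} {H ε δ : ℝ} (hm : 0 < m)
    (hd : 1 ≤ d) (hH : 0 < H) (hε : 0 < ε) (hδ : δ ∈ Set.Ioc 0 1)
    (hmc : 10 ^ 6 * (H / ε) ^ 2 * (d + Real.log (1 / δ)) ≤ m)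
    (cost : 𝒜 → X → ℝ) (hc : ∀ A x, cost A x ∈ Set.Icc 0 H)
    (hF : ∀ S : Finset X, PseudoShatters (Set.range cost) S → S.card ≤ d)
    (l : (Fin m → X) → 𝒜) (hl : Measurable fun p : (Fin m → X) × X => cost (l p.1) p.2) :
    MeasurableSet {p : (Fin m → X) × (Fin m → X) |
        m * (ε / 2) < |∑ i, (cost (l p.1) (p.2 i) - cost (l p.1) (p.1 i))|} ∧
    ((Measure.pi fun _ : Fin m => D).prod (Measure.pi fun _ : Fin m => D))
      {p | m * (ε / 2) < |∑ i, (cost (l p.1) (p.2 i) - cost (l p.1) (p.1 i))|}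
        ≤ ENNReal.ofReal (δ / 4) := by
  classical
  set μ := Measure.pi fun _ : Fin m => D with hμ
  set E := {p : (Fin m → X) × (Fin m → X) |
        m * (ε / 2) < |∑ i, (cost (l p.1) (p.2 i) - cost (l p.1) (p.1 i))|} with hE
  have hEm : MeasurableSet E := by
    refine measurableSet_lt measurable_const (_root_.measurable_abs.comp
      (Finset.measurable_sum _ fun i _ => Measurable.sub ?_ ?_))
    · exact hl.comp (measurable_fst.prodMk ((measurable_pi_apply i).comp measurable_snd))
    · exact hl.comp (measurable_fst.prodMk ((measurable_pi_apply i).comp measurable_fst))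
  refine ⟨hEm, ?_⟩
  have hσ : ∀ σ : Fin m → Bool,
      ∫⁻ p, (exchange σ ⁻¹' E).indicator (fun _ => (1 : ENNReal)) p ∂(μ.prod μ) = (μ.prod μ) E := by
    intro σ
    rw [lintegral_indicator_const ((measurePreserving_exchange D σ).measurable hEm), one_mul]
    exact (measurePreserving_exchange D σ).measure_preimage hEm.nullMeasurableSet
  have hsum : (2 : ENNReal) ^ m * (μ.prod μ) E
      = ∫⁻ p, ∑ σ : Fin m → Bool, (exchange σ ⁻¹' E).indicator (fun _ => (1 : ENNReal)) p ∂(μ.prod μ) := by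
    rw [lintegral_finsetSum _ fun σ _ =>
      measurable_const.indicator ((measurePreserving_exchange D σ).measurable hEm)]
    simp [hσ]
  -- The learner's output varies with `σ`, because its training half does; hence the bound over all
  -- `A` at once.
  have hpt : ∀ p, ∑ σ : Fin m → Bool, (exchange σ ⁻¹' E).indicator (fun _ => (1 : ENNReal)) p
      ≤ 2 ^ m * ENNReal.ofReal (δ / 4) := by
    intro p
    have h1 := card_signs_double_sample hm hd hH hε hδ hmc cost hc hF p.1 p.2
    have h2 : ∑ σ : Fin m → Bool, (exchange σ ⁻¹' E).indicator (fun _ => (1 : ENNReal)) p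
        ≤ ((Finset.univ.filter fun σ : Fin m → Bool =>
          ∃ A, m * (ε / 2) < |∑ i, sgn (σ i) * (cost A (p.2 i) - cost A (p.1 i))|).card
            : ENNReal) := by
      rw [← Finset.sum_boole]
      refine Finset.sum_le_sum fun σ _ => ?_
      by_cases hp : exchange σ p ∈ E
      · rw [if_pos]
        · exact Set.indicator_le_self' (fun _ _ => zero_le) p
        · refine ⟨l (exchange σ p).1, ?_⟩
          have h3 : ∑ i, sgn (σ i) * (cost (l (exchange σ p).1) (p.2 i)
              - cost (l (exchange σ p).1) (p.1 i))
              = ∑ i, (cost (l (exchange σ p).1) ((exchange σ p).2 i)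
                - cost (l (exchange σ p).1) ((exchange σ p).1 i)) := by
            refine Finset.sum_congr rfl fun i _ => ?_
            generalize l (exchange σ p).1 = A
            cases h : σ i <;> simp [sgn, exchange, h]
          rw [h3]
          exact hp
      · rw [Set.indicator_of_notMem (by exact hp)]
        exact zero_le
    refine h2.trans ?_
    have h3 := ENNReal.ofReal_le_ofReal h1
    rw [ENNReal.ofReal_mul (by positivity), ENNReal.ofReal_natCast,
      ENNReal.ofReal_pow (by norm_num)] at h3
    simpa using h3
  have h4 : (2 : ENNReal) ^ m * (μ.prod μ) E ≤ 2 ^ m * ENNReal.ofReal (δ / 4) := by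
    rw [hsum]
    refine (lintegral_mono hpt).trans ?_
    simp
  exact (ENNReal.mul_le_mul_iff_right (by simp) (by simp)).1 h4

/-- The output of a learner generalizes: its average cost is close to its expected cost. -/
lemma measureReal_generalization_gap_le {X 𝒜 : Type*} [MeasurableSpace X] [Nonempty 𝒜]
    (D : Measure X) [IsProbabilityMeasure D] {m d : ℕ} {H ε δ : ℝ} (hm : 0 < m)
    (hd : 1 ≤ d) (hH : 0 < H) (hε : 0 < ε) (hδ : δ ∈ Set.Ioc 0 1)
    (hmc : 10 ^ 6 * (H / ε) ^ 2 * (d + Real.log (1 / δ)) ≤ m)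
    (cost : 𝒜 → X → ℝ) (hc : ∀ A x, cost A x ∈ Set.Icc 0 H) (hcm : ∀ A, Measurable (cost A))
    (hF : ∀ S : Finset X, PseudoShatters (Set.range cost) S → S.card ≤ d)
    (l : (Fin m → X) → 𝒜) (hl : Measurable fun p : (Fin m → X) × X => cost (l p.1) p.2) :
    (Measure.pi fun _ : Fin m => D).real
      {x | m * ε < |∑ i, cost (l x) (x i) - m * expCost cost D (l x)|} ≤ δ / 2 := by
  have hm' : (0 : ℝ) < m := by exact_mod_cast hm
  obtain ⟨hEm, hE⟩ := measure_ghost_deviation_le D hm hd hH hε hδ hmc cost hc hF l hl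
  set μ := Measure.pi fun _ : Fin m => D with hμ
  set E := {p : (Fin m → X) × (Fin m → X) |
        m * (ε / 2) < |∑ i, (cost (l p.1) (p.2 i) - cost (l p.1) (p.1 i))|} with hEdef
  -- Given `x`, the output `l x` is one fixed function, so Hoeffding puts its ghost sum within `m *
  -- (ε / 2)` of the mean with probability at least `1 - δ / 2 ≥ 1 / 2`.
  have hsub : {x | m * ε < |∑ i, cost (l x) (x i) - m * expCost cost D (l x)|}
      ⊆ {x | ENNReal.ofReal (1 / 2) ≤ μ (Prod.mk x ⁻¹' E)} := by
    intro x hx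
    have h1 := measureReal_deviation_le D (hcm (l x)) hm hd hH hε hδ hmc (hc (l x))
    set G := {y : Fin m → X | m * (ε / 2) ≤
      |∑ i, cost (l x) (y i) - m * ∫ y, cost (l x) y ∂D|} with hG
    have h2 : Gᶜ ⊆ Prod.mk x ⁻¹' E := by
      intro y hy
      simp only [hG, Set.mem_compl_iff, Set.mem_ofPred_eq, not_le] at hy
      simp only [Set.mem_ofPred_eq, expCost] at hx
      simp only [hEdef, Set.mem_preimage, Set.mem_ofPred_eq, Finset.sum_sub_distrib]
      have h3 := abs_sub_le (∑ i, cost (l x) (x i)) (∑ i, cost (l x) (y i))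
        (m * ∫ y, cost (l x) y ∂D)
      rw [abs_sub_comm (∑ i, cost (l x) (x i)) (∑ i, cost (l x) (y i))] at h3
      linarith
    have h4 : (1 : ℝ) ≤ μ.real G + μ.real (Prod.mk x ⁻¹' E) := by
      have h5 : (Set.univ : Set (Fin m → X)) ⊆ G ∪ Prod.mk x ⁻¹' E := fun y _ => by
        by_cases hy : y ∈ G
        · exact Or.inl hy
        · exact Or.inr (h2 hy)
      have h6 := (measureReal_mono h5 (measure_ne_top μ _)).trans (measureReal_union_le _ _)
      simpa using h6
    refine (ENNReal.ofReal_le_iff_le_toReal (measure_ne_top μ _)).2 ?_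
    change 1 / 2 ≤ μ.real (Prod.mk x ⁻¹' E)
    linarith [hδ.2]
  -- Markov's inequality for the measure of the sections of `E`.
  have h7 : ENNReal.ofReal (1 / 2) * μ {x | ENNReal.ofReal (1 / 2) ≤ μ (Prod.mk x ⁻¹' E)}
      ≤ ENNReal.ofReal (δ / 4) := by
    refine (mul_meas_ge_le_lintegral (measurable_measure_prodMk_left hEm) _).trans ?_
    rwa [← Measure.prod_apply hEm]
  have h8 : 1 / 2 * μ.real {x | ENNReal.ofReal (1 / 2) ≤ μ (Prod.mk x ⁻¹' E)} ≤ δ / 4 := by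
    have := ENNReal.toReal_mono ENNReal.ofReal_ne_top h7
    rwa [ENNReal.toReal_mul, ENNReal.toReal_ofReal (by norm_num),
      ENNReal.toReal_ofReal (by linarith [hδ.1])] at this
  have h9 := measureReal_mono hsub (measure_ne_top μ _)
  linarith

/-! ### Analysis of empirical risk minimization -/

lemma card_le_of_pseudoDim_eq {X : Type*} {F : Set (X → ℝ)} {d : ℕ} (h : pseudoDim F = d)
    (S : Finset X) (hS : PseudoShatters F S) : S.card ≤ d := by
  have h1 : (S.card : ℕ∞) ≤ pseudoDim F :=
    le_iSup₂ (f := fun (S : Finset X) (_ : PseudoShatters F S) => (S.card : ℕ∞)) S hS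
  rw [h] at h1
  exact_mod_cast h1

/-- A class that is not a single function shatters a point. -/
lemma exists_pseudoShatters_singleton {X 𝒜 : Type*} {cost : 𝒜 → X → ℝ} {A B : 𝒜} {x : X}
    (h : cost A x < cost B x) : PseudoShatters (Set.range cost) {x} := by
  refine ⟨cost A, fun T hT => ?_⟩
  rcases Finset.subset_singleton_iff.1 hT with rfl | rfl
  · exact ⟨cost A, ⟨A, rfl⟩, by simp⟩
  · exact ⟨cost B, ⟨B, rfl⟩, by simpa using h⟩

/-- The expected performance of an element is no better than the best one, and some elements come
arbitrarily close. -/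
lemma best_spec {ι : Type*} [Nonempty ι] (goal : Goal) {v : ι → ℝ} {H η : ℝ}
    (hv : ∀ i, v i ∈ Set.Icc 0 H) (hη : 0 < η) :
    (∀ i, goal.AsGoodAs (goal.best v) (v i)) ∧ ∃ i, |v i - goal.best v| ≤ η := by
  cases goal with
  | minimize =>
    have hb : BddBelow (Set.range v) := ⟨0, by rintro _ ⟨i, rfl⟩; exact (hv i).1⟩
    refine ⟨fun i => ciInf_le hb i, ?_⟩
    obtain ⟨i, hi⟩ := exists_lt_of_ciInf_lt (show ⨅ i, v i < (⨅ i, v i) + η by linarith)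
    have := ciInf_le hb i
    exact ⟨i, abs_le.2 ⟨by simp only [Goal.best]; linarith, by simp only [Goal.best]; linarith⟩⟩
  | maximize =>
    have hb : BddAbove (Set.range v) := ⟨H, by rintro _ ⟨i, rfl⟩; exact (hv i).2⟩
    refine ⟨fun i => le_ciSup hb i, ?_⟩
    obtain ⟨i, hi⟩ := exists_lt_of_lt_ciSup (show (⨆ i, v i) - η < ⨆ i, v i by linarith)
    have := le_ciSup hb i
    exact ⟨i, abs_le.2 ⟨by simp only [Goal.best]; linarith, by simp only [Goal.best]; linarith⟩⟩

lemma expCost_mem_Icc {X 𝒜 : Type*} [MeasurableSpace X] {cost : 𝒜 → X → ℝ} {H : ℝ}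
    (hc : ∀ A x, cost A x ∈ Set.Icc 0 H) (hcm : ∀ A, Measurable (cost A)) (D : Measure X)
    [IsProbabilityMeasure D] (A : 𝒜) : expCost cost D A ∈ Set.Icc 0 H := by
  have hi : Integrable (cost A) D :=
    Integrable.of_mem_Icc 0 H (hcm A).aemeasurable (Filter.Eventually.of_forall (hc A))
  refine ⟨integral_nonneg fun x => (hc A x).1, ?_⟩
  have := integral_mono hi (integrable_const H) fun x => (hc A x).2
  simpa [expCost] using this

/-- Deterministic core of the analysis of empirical risk minimization. -/
lemma error_le_of_deviation {X 𝒜 : Type*} [MeasurableSpace X] (goal : Goal)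
    {cost : 𝒜 → X → ℝ} {D : Measure X} {m : ℕ} (hm : 0 < m) {ε : ℝ} {x : Fin m → X} {A B : 𝒜}
    (hbest : goal.AsGoodAs (goal.best (expCost cost D)) (expCost cost D A))
    (hB : |expCost cost D B - goal.best (expCost cost D)| ≤ ε / 2)
    (hAB : goal.AsGoodAs (avgCost cost x A) (avgCost cost x B))
    (hA : |∑ i, cost A (x i) - m * expCost cost D A| ≤ m * ε)
    (hBx : |∑ i, cost B (x i) - m * expCost cost D B| ≤ m * (ε / 2)) :
    error goal cost D A ≤ 2 * ε := by
  have hm' : (0 : ℝ) < m := by exact_mod_cast hm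
  rw [abs_le] at hB hA hBx
  unfold error
  cases goal with
  | minimize =>
    simp only [Goal.AsGoodAs, avgCost] at hbest hAB
    rw [div_le_div_iff_of_pos_right hm'] at hAB
    -- `3 * ε / 2` is the gap `ε` of `A` plus the gap `ε / 2` of `B`; the distance of `B` from the
    -- optimum adds the last `ε / 2`.
    have h1 : m * expCost cost D A ≤ m * (expCost cost D B + 3 * ε / 2) := by linarith
    have h2 := le_of_mul_le_mul_left h1 hm'
    rw [abs_le]
    constructor <;> linarith
  | maximize =>
    simp only [Goal.AsGoodAs, avgCost] at hbest hAB
    rw [div_le_div_iff_of_pos_right hm'] at hAB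
    have h1 : m * expCost cost D B ≤ m * (expCost cost D A + 3 * ε / 2) := by linarith
    have h2 := le_of_mul_le_mul_left h1 hm'
    rw [abs_le]
    constructor <;> linarith

/-- If all costs agree, every element is optimal. -/
lemma error_eq_zero_of_cost_eq {X 𝒜 : Type*} [MeasurableSpace X] (goal : Goal)
    {cost : 𝒜 → X → ℝ} (h : ∀ A B, cost A = cost B) (D : Measure X) (A : 𝒜) :
    error goal cost D A = 0 := by
  have : Nonempty 𝒜 := ⟨A⟩
  have h1 : expCost cost D = fun _ => expCost cost D A := by
    funext B; simp only [expCost, h B A]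
  unfold error
  rw [abs_eq_zero, sub_eq_zero]
  conv_rhs => rw [h1]
  cases goal <;> simp [Goal.best]

end AlgSelect

/-- The constant `c` is universal. The two measurability hypotheses say that expected costs make
sense, and that the cost of the learner's output on a fresh instance is a measurable function of
the sample and the fresh instance. -/
theorem corollary3p2 :
    ∃ c : ℝ, 0 < c ∧
      ∀ (X : Type*) [MeasurableSpace X] (𝒜 : Type*) (goal : AlgSelect.Goal)
        (cost : 𝒜 → X → ℝ) (H ε δ : ℝ) (d m : ℕ) (L : AlgSelect.Learner X 𝒜),
        (∀ A x, cost A x ∈ Set.Icc 0 H) →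
        (∀ A, Measurable (cost A)) →
        Measurable (fun p : (Fin m → X) × X => cost (L m p.1) p.2) →
        0 < ε → δ ∈ Set.Ioc 0 1 →
        AlgSelect.pseudoDim (Set.range cost) = d →
        AlgSelect.IsERM goal cost L →
        c * (H / ε) ^ 2 * (d + Real.log (1 / δ)) ≤ m →
        AlgSelect.LearnsOptimal goal cost L (2 * ε) δ m := by
  refine ⟨10 ^ 6, by norm_num, ?_⟩
  intro X _ 𝒜 goal cost H ε δ d m L hc hcm hLm hε hδ hdim hERM hmc D _
  -- This case is separate because `d = 0` with `δ = 1` admits `m = 0`; otherwise `d`, `H` and `m`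
  -- are all positive.
  by_cases heq : ∀ A B, cost A = cost B
  · have : {x | AlgSelect.error goal cost D (L m x) ≤ 2 * ε} = Set.univ := by
      ext x
      simp only [AlgSelect.error_eq_zero_of_cost_eq goal heq, Set.mem_ofPred_eq, Set.mem_univ,
        iff_true]
      positivity
    rw [this]
    simpa using hδ.1.le
  have hF := AlgSelect.card_le_of_pseudoDim_eq hdim
  obtain ⟨A, B, x, hx⟩ : ∃ A B x, cost A x < cost B x := by
    by_contra! hcon
    exact heq fun A B => funext fun x => le_antisymm (hcon B A x) (hcon A B x)
  have hd : 1 ≤ d := by simpa using hF _ (AlgSelect.exists_pseudoShatters_singleton hx)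
  have hH : 0 < H := ((hc A x).1.trans_lt hx).trans_le (hc B x).2
  have hl0 : 0 ≤ Real.log (1 / δ) := Real.log_nonneg (by rw [le_div_iff₀ hδ.1]; linarith [hδ.2])
  have hm : 0 < m := by
    have hd1 : (1 : ℝ) ≤ d := by exact_mod_cast hd
    have : (0 : ℝ) < m := lt_of_lt_of_le (by positivity) hmc
    exact_mod_cast this
  have : Nonempty 𝒜 := ⟨A⟩
  obtain ⟨hbest, A', hA'⟩ := AlgSelect.best_spec goal (AlgSelect.expCost_mem_Icc hc hcm D)
    (half_pos hε)
  have h1 := AlgSelect.measureReal_generalization_gap_le D hm hd hH hε hδ hmc cost hc hcm hF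
    (L m) hLm
  have h2 := AlgSelect.measureReal_deviation_le D (hcm A') hm hd hH hε hδ hmc (hc A')
  set μ := Measure.pi fun _ : Fin m => D with hμ
  set S := {x : Fin m → X | AlgSelect.error goal cost D (L m x) ≤ 2 * ε} with hS
  set B₁ := {x : Fin m → X |
    m * ε < |∑ i, cost (L m x) (x i) - m * AlgSelect.expCost cost D (L m x)|} with hB₁
  set B₂ := {x : Fin m → X |
    m * (ε / 2) ≤ |∑ i, cost A' (x i) - m * ∫ y, cost A' y ∂D|} with hB₂
  -- Only subadditivity is applied to this cover, so the three sets need not be shown measurable.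
  have hcover : (Set.univ : Set (Fin m → X)) ⊆ S ∪ (B₁ ∪ B₂) := by
    intro x _
    by_cases hx1 : x ∈ B₁
    · exact Or.inr (Or.inl hx1)
    by_cases hx2 : x ∈ B₂
    · exact Or.inr (Or.inr hx2)
    simp only [hB₁, hB₂, Set.mem_ofPred_eq, not_lt, not_le] at hx1 hx2
    exact Or.inl (AlgSelect.error_le_of_deviation goal hm (hbest _) hA' (hERM m x A') hx1 hx2.le)
  have h3 := (measureReal_mono hcover (measure_ne_top μ _)).trans (measureReal_union_le _ _)
  have h4 := measureReal_union_le (μ := μ) B₁ B₂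
  rw [probReal_univ] at h3
  linarith
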